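/- Let $Z$ be a real random variable (not necessarily nonnegative) with $0<\mathbb{E}Z<\infty$ whose law is non-arithmetic, i.e. its support is not contained in $d\mathbb{Z}$ for any $d>0$. Let $Z_1,Z_2,\dots$ be independent copies of $Z$, let $S_0=0$ and $S_n=Z_1+\dots+Z_n$, and let $$H(B)=\sum_{n=0}^\infty \mathbb{P}(S_n\in B),\qquad B\subseteq\mathbb{R}\ \text{Borel},$$ be the renewal measure. Let $L:(0,\infty)\to(0,\infty)$ be a slowly varying function, i.e. $L$ is Borel measurable and $L(\lambda x)/L(x)\to 1$ as $x\to\infty$ for every $\lambda>0$, and assume that $L$ is locally bounded on $[1,\infty)$, i.e. bounded on every compact subset of $[1,\infty)$. Let $x_0\ge 0$ be such that $$\widetilde L(x_0,x)=\int_{x_0}^x \frac{L(t)}{t}\,dt$$ is finite for every $x>x_0$ and $\widetilde L(x_0,x)\to\infty$ as $x\to\infty$. Then the function $z\mapsto L(e^{x-z})$ is $H$-integrable on $(0,x]$ for every real $x$, and $$\int_{(0,x]} L\left(e^{x-z}\right)H(dz)\sim\frac{1}{\mathbb{E}Z}\,\widetilde L(x_0,e^x)\qquad\text{as }x\to\infty,$$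 where $f(x)\sim g(x)$ means that $f(x)/g(x)\to1$ as $x\to\infty$. -/

import Mathlib

open MeasureTheory ProbabilityTheory Filter Topology Set

namespace Renewal

/-- A Borel measurable function `f : (0, ∞) → (0, ∞)` is regularly varying with index `ρ` if
`f (c x) / f x → c ^ ρ` as `x → ∞` for every `c > 0`.  Functions on `(0, ∞)` are represented by
functions on `ℝ` whose values outside `(0, ∞)` play no role. -/
structure IsRegularlyVarying (f : ℝ → ℝ) (ρ : ℝ) : Prop where
  measurable : Measurable fun x : Ioi (0 : ℝ) => f x
  pos : ∀ x : ℝ, 0 < x → 0 < f x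
  tendsto : ∀ c : ℝ, 0 < c → Tendsto (fun x : ℝ => f (c * x) / f x) atTop (𝓝 (c ^ ρ))

/-- Slowly varying means regularly varying with index `0`. -/
def IsSlowlyVarying (f : ℝ → ℝ) : Prop := IsRegularlyVarying f 0

/-- `f` is bounded on every compact subset of `s`. -/
def LocallyBoundedOn (f : ℝ → ℝ) (s : Set ℝ) : Prop :=
  ∀ K : Set ℝ, K ⊆ s → IsCompact K → Bornology.IsBounded (f '' K)

/-- A law on `ℝ` is arithmetic if its support is contained in `dℤ` for some `d > 0`. -/
def IsArithmetic (μ : Measure ℝ) : Prop :=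
  ∃ d : ℝ, 0 < d ∧ μ.support ⊆ {x : ℝ | ∃ k : ℤ, x = k * d}

/-- The walk `S_n`, the sum of the first `n` increments (the increments are indexed from `0`). -/
def partialSum {Ω : Type*} (Z : ℕ → Ω → ℝ) (n : ℕ) (ω : Ω) : ℝ :=
  ∑ k ∈ Finset.range n, Z k ω

/-- The renewal measure `H(B) = ∑_{n ≥ 0} P(S_n ∈ B)` of the walk `S_n`. -/
noncomputable def renewalMeasure {Ω : Type*} [MeasurableSpace Ω] (P : Measure Ω)
    (Z : ℕ → Ω → ℝ) : Measure ℝ :=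
  Measure.sum fun n : ℕ => P.map (partialSum Z n)

theorem renewalMeasure_apply {Ω : Type*} [MeasurableSpace Ω] (P : Measure Ω) (Z : ℕ → Ω → ℝ)
    (hZ : ∀ k, AEMeasurable (Z k) P) {B : Set ℝ} (hB : MeasurableSet B) :
    renewalMeasure P Z B = ∑' n : ℕ, P {ω | partialSum Z n ω ∈ B} := by
  rw [renewalMeasure, Measure.sum_apply _ hB]
  refine tsum_congr fun n => ?_
  have h : AEMeasurable (partialSum Z n) P := by
    unfold partialSum
    exact Finset.aemeasurable_fun_sum _ fun k _ => hZ k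
  exact Measure.map_apply_of_aemeasurable h hB

/-- The function `L̃(x₀, x) = ∫_{x₀}^x t⁻¹ L(t) dt`. -/
noncomputable def deHaan (L : ℝ → ℝ) (x₀ x : ℝ) : ℝ := ∫ t in x₀..x, t⁻¹ * L t

end Renewal

/-!
Write `S_n` for the walk, `m = E Z` for the drift, `H` for the renewal measure and
`f y = L (exp y)`, so that `f (y + u) / f y → 1`. With `t = exp y`, the function `L̃(x₀, exp x)`
differs from `∫₀ˣ f` by a constant, and the claim reads
`∫_{(0, x]} f (x - z) H(dz) ∼ m⁻¹ ∫₀ˣ f`.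

Since `f` is nearly constant on windows of any fixed length `h`, uniformly near infinity
(`exists_forall_le_mul`), `f (x - z)` may be replaced by its average over a window of length `h`,
and Tonelli's theorem turns the convolution into `h⁻¹ ∫ f (x - w) H([w - h, w]) dw`. It therefore
suffices to know that `H([w - h, w]) / h` is close to `1 / m` for a suitable large `h` and all
`w ≥ h`. The end points are harmless: near `z = x` the function `f (x - z)` is bounded, and near
`z = 0` a window contributes `O(f x)`, which is `o(∫₀ˣ f)` (`tendsto_integral_window_div`).

The information about `H` has two parts.

* Unit intervals have uniformly bounded renewal measure (`exists_renewalMeasure_Icc_le`). By the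
  strong law there are `m₀` and `q > 0` such that with probability `q` the walk stays above `1` from
  time `m₀` on. After a visit to a unit interval the walk thus leaves it for good within `m₀` steps
  with probability at least `q`, and this can happen for at most `m₀` visits, so `H(I) q ≤ m₀`.
* Long intervals have almost the right measure (`exists_abs_renewalMeasure_Icc_sub_le`). Let `G` be
  the ramp `y ↦ max 0 (min y h)`. Telescoping gives `∑ₙ E [G (x - S_n) - G (x - S_{n+1})] = h` for
  `x ≥ h`. Linearizing, `G y - G (y - c) ≈ c 1_{[0, h]}(y)`, the sum becomes `m H([x - h, x])`. By
  the first part the total linearization error is `O(E [|Z| min(|Z| + 1, h)])`, which is `o(h)`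
  because `Z` is integrable.
-/

namespace Renewal

/-! ### Uniform bounds for the renewal measure on bounded intervals -/

theorem partialSum_zero {Ω : Type*} (X : ℕ → Ω → ℝ) (ω : Ω) : partialSum X 0 ω = 0 := by simp [partialSum]

theorem partialSum_succ {Ω : Type*} (X : ℕ → Ω → ℝ) (n : ℕ) (ω : Ω) :
    partialSum X (n + 1) ω = partialSum X n ω + X n ω := by
  simp [partialSum, Finset.sum_range_succ]

theorem partialSum_add {Ω : Type*} (X : ℕ → Ω → ℝ) (n j : ℕ) (ω : Ω) :
    partialSum X (n + j) ω = partialSum X n ω + partialSum (fun i => X (n + i)) j ω := by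
  simp [partialSum, Finset.sum_range_add]

section Walk

variable {Ω : Type*} [MeasurableSpace Ω] {P : Measure Ω} {X : ℕ → Ω → ℝ}

theorem measurable_partialSum (hX : ∀ k, Measurable (X k)) (n : ℕ) :
    Measurable (partialSum X n) := by
  unfold partialSum
  fun_prop

/-- A walk with positive drift tends to infinity almost surely, by the strong law. -/
theorem ae_tendsto_partialSum_atTop (h_indep : iIndepFun X P)
    (h_id : ∀ k, IdentDistrib (X k) (X 0) P P) (h_int : Integrable (X 0) P)
    (h_pos : 0 < ∫ ω, X 0 ω ∂P) :
    ∀ᵐ ω ∂P, Tendsto (fun n => partialSum X n ω) atTop atTop := by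
  have h := strong_law_ae_real X h_int (fun i j hij => h_indep.indepFun hij) h_id
  filter_upwards [h] with ω hω
  have h2 := hω.pos_mul_atTop h_pos tendsto_natCast_atTop_atTop
  refine h2.congr' ?_
  filter_upwards [eventually_gt_atTop 0] with n hn
  have : (n : ℝ) ≠ 0 := by positivity
  simp only [partialSum]
  field_simp

theorem exists_measure_forall_one_lt_partialSum_pos [IsProbabilityMeasure P]
    (h_indep : iIndepFun X P)
    (h_id : ∀ k, IdentDistrib (X k) (X 0) P P) (h_int : Integrable (X 0) P)
    (h_pos : 0 < ∫ ω, X 0 ω ∂P) :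
    ∃ m : ℕ, 0 < P {ω | ∀ j ≥ m, 1 < partialSum X j ω} := by
  by_contra! h
  have h0 : P (⋃ m : ℕ, {ω | ∀ j ≥ m, 1 < partialSum X j ω}) = 0 :=
    measure_iUnion_null fun m => le_antisymm (h m) bot_le
  have h1 : ∀ᵐ ω ∂P, ω ∈ ⋃ m : ℕ, {ω | ∀ j ≥ m, 1 < partialSum X j ω} := by
    filter_upwards [ae_tendsto_partialSum_atTop h_indep h_id h_int h_pos] with ω hω
    exact mem_iUnion.2 (eventually_atTop.1 (hω.eventually_gt_atTop 1))
  have h2 : ∀ᵐ ω ∂P, ω ∉ ⋃ m : ℕ, {ω | ∀ j ≥ m, 1 < partialSum X j ω} :=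
    measure_eq_zero_iff_ae_notMem.1 h0
  obtain ⟨ω, hω1, hω2⟩ := (h1.and h2).exists
  exact hω2 hω1

/-- The Markov property at a fixed time: after time `n` the walk behaves like a fresh copy of
itself, independent of its position at time `n`. -/
theorem measure_partialSum_mem_inter_forall_one_lt [IsProbabilityMeasure P]
    (hX : ∀ k, Measurable (X k)) (h_indep : iIndepFun X P)
    (h_id : ∀ k, IdentDistrib (X k) (X 0) P P) (m n : ℕ) {B : Set ℝ} (hB : MeasurableSet B) :
    P ({ω | partialSum X n ω ∈ B} ∩
        {ω | ∀ j ≥ m, 1 < partialSum (fun i => X (n + i)) j ω}) =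
      P {ω | partialSum X n ω ∈ B} * P {ω | ∀ j ≥ m, 1 < partialSum X j ω} := by
  let F : Set (ℕ → ℝ) := {f | ∀ j ≥ m, 1 < ∑ i ∈ Finset.range j, f i}
  have hF : MeasurableSet F := by
    have : F = ⋂ j ≥ m, {f : ℕ → ℝ | 1 < ∑ i ∈ Finset.range j, f i} := by
      ext f; simp [F]
    rw [this]
    refine MeasurableSet.iInter fun j => MeasurableSet.iInter fun _ => ?_
    exact measurableSet_lt measurable_const (by fun_prop)
  have hlaw : P {ω | ∀ j ≥ m, 1 < partialSum (fun i => X (n + i)) j ω} =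
      P {ω | ∀ j ≥ m, 1 < partialSum X j ω} := by
    have e1 := h_indep.map_fun_eq_infinitePi_map hX
    have e2 := (h_indep.precomp (add_right_injective n)).map_fun_eq_infinitePi_map
      (fun i => hX (n + i))
    have e3 : (fun i => P.map (X (n + i))) = fun i => P.map (X i) := by
      funext i
      rw [(h_id (n + i)).map_eq, (h_id i).map_eq]
    simp only [e3] at e2
    have e4 := e2.trans e1.symm
    have e5 := congrArg (fun ρ => ρ F) e4
    rw [Measure.map_apply (by fun_prop) hF, Measure.map_apply (by fun_prop) hF] at e5
    exact e5
  rw [← hlaw]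
  have hI := indep_iSup_of_disjoint (m := fun i => MeasurableSpace.comap (X i) inferInstance)
    (fun i => (hX i).comap_le) h_indep.iIndep (S := Iio n) (T := Ici n)
    (Set.disjoint_left.2 fun a ha hb => not_lt_of_ge (mem_Ici.1 hb) (mem_Iio.1 ha))
  have hmeas : ∀ (S : Set ℕ) (i : ℕ), i ∈ S →
      Measurable[⨆ i ∈ S, MeasurableSpace.comap (X i) inferInstance] (X i) := by
    intro S i hi
    exact measurable_iff_comap_le.2
      (le_biSup (fun i => MeasurableSpace.comap (X i) inferInstance) hi)
  refine (Indep_iff _ _ P).1 hI _ _ ?_ ?_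
  · have : Measurable[⨆ i ∈ Iio n, MeasurableSpace.comap (X i) inferInstance]
        (partialSum X n) := by
      unfold partialSum
      exact Finset.measurable_fun_sum _ fun i hi => hmeas _ i (Finset.mem_range.1 hi)
    exact this hB
  · have : Measurable[⨆ i ∈ Ici n, MeasurableSpace.comap (X i) inferInstance]
        (fun ω i => X (n + i) ω) := by
      rw [@measurable_pi_iff]
      exact fun i => hmeas _ _ (Nat.le_add_right n i)
    exact this hF

/-- Call `n` a late visit if `S_n` lies in `[x, x + 1]` and the walk moves up by more than `1` after
any further `m` or more steps. All late visits lie within `m` steps of each other, so there are at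
most `m` of them, and by the Markov property their expected number is the left-hand side. -/
theorem renewalMeasure_apply_mul_le [IsProbabilityMeasure P]
    (hX : ∀ k, Measurable (X k)) (h_indep : iIndepFun X P)
    (h_id : ∀ k, IdentDistrib (X k) (X 0) P P) (m : ℕ) (x : ℝ) :
    renewalMeasure P X (Icc x (x + 1)) * P {ω | ∀ j ≥ m, 1 < partialSum X j ω} ≤ m := by
  let E : ℕ → Set Ω := fun n => {ω | partialSum X n ω ∈ Icc x (x + 1)} ∩
        {ω | ∀ j ≥ m, 1 < partialSum (fun i => X (n + i)) j ω}
  have hE : ∀ n, MeasurableSet (E n) := by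
    intro n
    refine (measurable_partialSum hX n measurableSet_Icc).inter ?_
    simp only [ofPred_forall]
    refine MeasurableSet.iInter fun j => MeasurableSet.iInter fun _ => ?_
    exact measurableSet_lt measurable_const (measurable_partialSum (fun i => hX (n + i)) j)
  rw [renewalMeasure_apply P X (fun k => (hX k).aemeasurable) measurableSet_Icc,
    ← ENNReal.tsum_mul_right]
  have h1 : ∀ n, P {ω | partialSum X n ω ∈ Icc x (x + 1)} *
      P {ω | ∀ j ≥ m, 1 < partialSum X j ω} = ∫⁻ ω, (E n).indicator 1 ω ∂P := by
    intro n
    rw [lintegral_indicator_one (hE n),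
      measure_partialSum_mem_inter_forall_one_lt hX h_indep h_id m n measurableSet_Icc]
  simp_rw [h1]
  rw [← lintegral_tsum fun n => ((measurable_one.indicator (hE n)).aemeasurable)]
  calc ∫⁻ ω, ∑' n, (E n).indicator 1 ω ∂P ≤ ∫⁻ _, (m : ENNReal) ∂P := by
        refine lintegral_mono fun ω => ?_
        refine ENNReal.tsum_le_of_sum_range_le fun N => ?_
        classical
        have : ∑ n ∈ Finset.range N, (E n).indicator (1 : Ω → ENNReal) ω =
            (((Finset.range N).filter fun n => ω ∈ E n).card : ENNReal) := by
          rw [Finset.card_filter, Nat.cast_sum]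
          exact Finset.sum_congr rfl fun n _ => by by_cases h : ω ∈ E n <;> simp [h]
        rw [this]
        norm_cast
        -- two times at which the event occurs are less than `m` apart
        have key : ∀ a b, ω ∈ E a → ω ∈ E b → b < a + m := by
          intro a b ha hb
          by_contra! hab
          obtain ⟨c, rfl⟩ := Nat.exists_eq_add_of_le (le_trans (Nat.le_add_right a m) hab)
          have h2 := ha.2 c (by omega)
          have h3 := hb.1.2
          have h4 := ha.1.1
          rw [partialSum_add] at h3
          linarith
        rcases ((Finset.range N).filter fun n => ω ∈ E n).eq_empty_or_nonempty with h0 | h0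
        · simp [h0]
        · obtain ⟨a, ha, hmin⟩ := Finset.exists_min_image _ id h0
          have hsub : ((Finset.range N).filter fun n => ω ∈ E n) ⊆ Finset.Ico a (a + m) := by
            intro b hb
            exact Finset.mem_Ico.2
              ⟨hmin b hb, key a b (Finset.mem_filter.1 ha).2 (Finset.mem_filter.1 hb).2⟩
          simpa using Finset.card_le_card hsub
    _ = m := by simp

/-- A walk with positive drift spends a bounded expected time in any interval, uniformly in the
position of the interval. -/
theorem exists_renewalMeasure_Icc_le [IsProbabilityMeasure P]
    (hX : ∀ k, Measurable (X k)) (h_indep : iIndepFun X P)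
    (h_id : ∀ k, IdentDistrib (X k) (X 0) P P) (h_int : Integrable (X 0) P)
    (h_pos : 0 < ∫ ω, X 0 ω ∂P) :
    ∃ C : ℝ, 0 < C ∧ ∀ x r : ℝ, 0 ≤ r →
      renewalMeasure P X (Icc x (x + r)) ≤ ENNReal.ofReal (C * (r + 1)) := by
  obtain ⟨m, hm⟩ := exists_measure_forall_one_lt_partialSum_pos h_indep h_id h_int h_pos
  set q := P {ω | ∀ j ≥ m, 1 < partialSum X j ω} with hq
  have hfin : (m : ENNReal) / q ≠ ⊤ := ENNReal.div_ne_top (by simp) hm.ne'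
  have hunit : ∀ x, renewalMeasure P X (Icc x (x + 1)) ≤
      ENNReal.ofReal (((m : ENNReal) / q).toReal + 1) := by
    intro x
    have h1 : renewalMeasure P X (Icc x (x + 1)) ≤ m / q := by
      rw [ENNReal.le_div_iff_mul_le (Or.inl hm.ne') (Or.inl (measure_ne_top _ _))]
      exact renewalMeasure_apply_mul_le hX h_indep h_id m x
    refine h1.trans ?_
    exact (ENNReal.le_ofReal_iff_toReal_le hfin (by positivity)).2 (by linarith)
  refine ⟨((m : ENNReal) / q).toReal + 1, by positivity, fun x r hr => ?_⟩
  have hcov : Icc x (x + r) ⊆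
      ⋃ i ∈ Finset.range (⌊r⌋₊ + 1), Icc (x + i) (x + i + 1) := by
    intro y hy
    have hy0 : 0 ≤ y - x := by linarith [hy.1]
    simp only [mem_iUnion]
    refine ⟨⌊y - x⌋₊, Finset.mem_range.2 ?_, ?_, ?_⟩
    · exact Nat.lt_succ_of_le (Nat.floor_le_floor (by linarith [hy.2]))
    · linarith [Nat.floor_le hy0]
    · linarith [Nat.lt_floor_add_one (y - x)]
  calc renewalMeasure P X (Icc x (x + r))
      ≤ ∑ i ∈ Finset.range (⌊r⌋₊ + 1), renewalMeasure P X (Icc (x + i) (x + i + 1)) :=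
        (measure_mono hcov).trans (measure_biUnion_finset_le _ _)
    _ ≤ ∑ i ∈ Finset.range (⌊r⌋₊ + 1), ENNReal.ofReal (((m : ENNReal) / q).toReal + 1) :=
        Finset.sum_le_sum fun i _ => hunit _
    _ = ENNReal.ofReal ((((m : ENNReal) / q).toReal + 1) * (⌊r⌋₊ + 1)) := by
        rw [Finset.sum_const, Finset.card_range, nsmul_eq_mul, mul_comm,
          ENNReal.ofReal_mul (by positivity)]
        congr 1
        rw [ENNReal.ofReal_add (by positivity) zero_le_one]
        simp
    _ ≤ _ := by
        refine ENNReal.ofReal_le_ofReal ?_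
        gcongr
        exact Nat.floor_le hr

end Walk

/-! ### The renewal measure of long intervals -/

/-- The ramp function: the primitive of the indicator of `[0, h]`, i.e. `y` clamped to `[0, h]`. -/
noncomputable def ramp (h y : ℝ) : ℝ := max 0 (min y h)

theorem ramp_nonneg (h y : ℝ) : 0 ≤ ramp h y := le_max_left _ _

theorem ramp_le {h : ℝ} (hh : 0 ≤ h) (y : ℝ) : ramp h y ≤ h := max_le hh (min_le_right _ _)

theorem ramp_of_le {h y : ℝ} (hh : 0 ≤ h) (hy : h ≤ y) : ramp h y = h := by
  simp [ramp, hy, hh]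

theorem ramp_of_nonpos {h y : ℝ} (hy : y ≤ 0) : ramp h y = 0 := by
  rw [ramp, max_eq_left]
  exact (min_le_left _ _).trans hy

theorem continuous_ramp (h : ℝ) : Continuous (ramp h) := by
  unfold ramp
  fun_prop

/-- The error made in replacing the increment `ramp h y - ramp h (y - c)` by its linearization
`c * 1_{[0, h]}(y)`. -/
noncomputable def rampError (h y c : ℝ) : ℝ :=
  |ramp h y - ramp h (y - c) - c * (Icc 0 h).indicator 1 y|

theorem measurable_rampError (h : ℝ) : Measurable fun p : ℝ × ℝ => rampError h p.1 p.2 := by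
  have h1 : Measurable ((Icc (0 : ℝ) h).indicator (1 : ℝ → ℝ)) :=
    measurable_one.indicator measurableSet_Icc
  have h2 := (continuous_ramp h).measurable
  unfold rampError
  fun_prop

/-- The linearization is exact unless `y` is within `|c|` of one of the two kinks of the ramp. -/
theorem rampError_le_of_kinks {h : ℝ} (hh : 0 ≤ h) (y c : ℝ) :
    rampError h y c ≤ |c| * (Icc (-|c|) |c|).indicator 1 y +
      |c| * (Icc (h - |c|) (h + |c|)).indicator 1 y := by
  have key : rampError h y c ≤ |c| := by
    unfold rampError ramp
    simp only [Set.indicator_apply, mem_Icc, Pi.one_apply]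
    split_ifs <;> rcases abs_cases c with ⟨e, _⟩ | ⟨e, _⟩ <;> rw [e, abs_le] <;>
      constructor <;> rcases max_cases 0 (min y h) with h1 | h1 <;>
      rcases max_cases 0 (min (y - c) h) with h2 | h2 <;>
      rcases min_cases y h with h3 | h3 <;> rcases min_cases (y - c) h with h4 | h4 <;>
      grind
  by_cases h1 : y ∈ Icc (-|c|) |c|
  · have : 0 ≤ |c| * (Icc (h - |c|) (h + |c|)).indicator 1 y :=
      mul_nonneg (abs_nonneg _) (Set.indicator_nonneg (fun _ _ => zero_le_one) _)
    rw [Set.indicator_of_mem h1]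
    simp only [Pi.one_apply]
    linarith
  by_cases h2 : y ∈ Icc (h - |c|) (h + |c|)
  · rw [Set.indicator_of_notMem h1, Set.indicator_of_mem h2]
    simp only [Pi.one_apply]
    linarith
  rw [Set.indicator_of_notMem h1, Set.indicator_of_notMem h2]
  refine le_of_eq ?_
  simp only [mul_zero, add_zero]
  unfold rampError ramp
  simp only [mem_Icc] at h1 h2
  simp only [Set.indicator_apply, mem_Icc, Pi.one_apply]
  rw [abs_eq_zero]
  split_ifs <;> rcases abs_cases c with ⟨e, _⟩ | ⟨e, _⟩ <;> rw [e] at h1 h2 <;>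
      rcases max_cases 0 (min y h) with h1 | h1 <;>
      rcases max_cases 0 (min (y - c) h) with h2 | h2 <;>
      rcases min_cases y h with h3 | h3 <;> rcases min_cases (y - c) h with h4 | h4 <;>
      grind

/-- For jumps `c` longer than the ramp, the boundedness of the ramp gives a better estimate. -/
theorem rampError_le_of_long_jump {h c : ℝ} (hh : 0 ≤ h) (hc : h < |c|) (y : ℝ) :
    rampError h y c ≤ |c| * (Icc 0 h).indicator 1 y +
      h * (Icc (-(2 * |c|)) (2 * |c|)).indicator 1 y := by
  have h1 : rampError h y c ≤ |ramp h y - ramp h (y - c)| + |c| * (Icc 0 h).indicator 1 y := by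
    unfold rampError
    refine (abs_sub _ _).trans ?_
    rw [abs_mul, abs_of_nonneg (a := (Icc 0 h).indicator 1 y)
      (Set.indicator_nonneg (fun _ _ => zero_le_one) _)]
  have h2 : |ramp h y - ramp h (y - c)| ≤
      h * (Icc (-(2 * |c|)) (2 * |c|)).indicator 1 y := by
    by_cases hy : y ∈ Icc (-(2 * |c|)) (2 * |c|)
    · rw [Set.indicator_of_mem hy, Pi.one_apply, mul_one, abs_le]
      constructor <;> linarith [ramp_nonneg h y, ramp_nonneg h (y - c), ramp_le hh y,
        ramp_le hh (y - c)]
    · rw [Set.indicator_of_notMem hy, mul_zero, abs_nonpos_iff, sub_eq_zero]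
      have h3 := neg_abs_le c
      have h4 := le_abs_self c
      rcases lt_or_ge y (-(2 * |c|)) with h5 | h5
      · rw [ramp_of_nonpos, ramp_of_nonpos] <;> linarith
      · have h6 : 2 * |c| < y := not_le.1 fun h6 => hy ⟨h5, h6⟩
        rw [ramp_of_le hh, ramp_of_le hh] <;> linarith
  linarith

section Walk

variable {Ω : Type*} [MeasurableSpace Ω] {P : Measure Ω} {X : ℕ → Ω → ℝ}

theorem lintegral_indicator_sub_Icc (H : Measure ℝ) (a x b c : ℝ) :
    ∫⁻ z, ENNReal.ofReal (a * (Icc b c).indicator 1 (x - z)) ∂H =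
      ENNReal.ofReal a * H (Icc (x - c) (x - b)) := by
  have : ∀ z, ENNReal.ofReal (a * (Icc b c).indicator 1 (x - z)) =
      (Icc (x - c) (x - b)).indicator (fun _ => ENNReal.ofReal a) z := by
    intro z
    by_cases hz : z ∈ Icc (x - c) (x - b)
    · have : x - z ∈ Icc b c := ⟨by linarith [hz.2], by linarith [hz.1]⟩
      simp [Set.indicator_of_mem hz, Set.indicator_of_mem this]
    · have : x - z ∉ Icc b c := fun h => hz ⟨by linarith [h.2], by linarith [h.1]⟩
      simp [Set.indicator_of_notMem hz, Set.indicator_of_notMem this]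
  simp_rw [this]
  rw [lintegral_indicator_const measurableSet_Icc]

theorem measurable_indicator_sub (a x b c : ℝ) :
    Measurable fun z : ℝ => ENNReal.ofReal (a * (Icc b c).indicator 1 (x - z)) := by
  have : Measurable ((Icc b c).indicator (1 : ℝ → ℝ)) :=
    measurable_one.indicator measurableSet_Icc
  fun_prop

/-- The accumulated linearization error for jumps of size `c`: it is `O(|c|)` times `|c| + 1` for
short jumps, and times `h` for long ones. -/
theorem lintegral_rampError_le {H : Measure ℝ} {C : ℝ} (hC : 0 < C)
    (hH : ∀ x r : ℝ, 0 ≤ r → H (Icc x (x + r)) ≤ ENNReal.ofReal (C * (r + 1)))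
    {h : ℝ} (hh : 1 ≤ h) (x c : ℝ) :
    ∫⁻ z, ENNReal.ofReal (rampError h (x - z) c) ∂H ≤
      ENNReal.ofReal (8 * C * (|c| * min (|c| + 1) h)) := by
  have hc := abs_nonneg c
  have hH' : ∀ a b, a ≤ b → H (Icc a b) ≤ ENNReal.ofReal (C * (b - a + 1)) := by
    intro a b hab
    have := hH a (b - a) (by linarith)
    rwa [add_sub_cancel] at this
  rcases le_or_gt |c| h with hch | hch
  · calc ∫⁻ z, ENNReal.ofReal (rampError h (x - z) c) ∂H
        ≤ ∫⁻ z, (ENNReal.ofReal (|c| * (Icc (-|c|) |c|).indicator 1 (x - z)) +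
            ENNReal.ofReal (|c| * (Icc (h - |c|) (h + |c|)).indicator 1 (x - z))) ∂H := by
          refine lintegral_mono fun z => ?_
          exact (ENNReal.ofReal_le_ofReal (rampError_le_of_kinks (by linarith) _ _)).trans
            ENNReal.ofReal_add_le
      _ = ENNReal.ofReal |c| * H (Icc (x - |c|) (x - -|c|)) +
            ENNReal.ofReal |c| * H (Icc (x - (h + |c|)) (x - (h - |c|))) := by
          rw [lintegral_add_left (measurable_indicator_sub _ _ _ _),
            lintegral_indicator_sub_Icc, lintegral_indicator_sub_Icc]
      _ ≤ ENNReal.ofReal |c| * ENNReal.ofReal (C * (2 * |c| + 1)) +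
            ENNReal.ofReal |c| * ENNReal.ofReal (C * (2 * |c| + 1)) := by
          gcongr
          · refine (hH' _ _ (by linarith)).trans (le_of_eq ?_)
            congr 2; ring
          · refine (hH' _ _ (by linarith)).trans (le_of_eq ?_)
            congr 2; ring
      _ = ENNReal.ofReal (|c| * (C * (2 * |c| + 1)) + |c| * (C * (2 * |c| + 1))) := by
          rw [ENNReal.ofReal_add (by positivity) (by positivity), ENNReal.ofReal_mul hc]
      _ ≤ _ := by
          refine ENNReal.ofReal_le_ofReal ?_
          have h1 : 2 * |c| + 1 ≤ 4 * min (|c| + 1) h := by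
            rcases min_cases (|c| + 1) h with h2 | h2 <;> linarith
          have h2 := mul_le_mul_of_nonneg_left h1 (by positivity : 0 ≤ 2 * (C * |c|))
          linarith
  · calc ∫⁻ z, ENNReal.ofReal (rampError h (x - z) c) ∂H
        ≤ ∫⁻ z, (ENNReal.ofReal (|c| * (Icc 0 h).indicator 1 (x - z)) +
            ENNReal.ofReal (h * (Icc (-(2 * |c|)) (2 * |c|)).indicator 1 (x - z))) ∂H := by
          refine lintegral_mono fun z => ?_
          exact (ENNReal.ofReal_le_ofReal
            (rampError_le_of_long_jump (by linarith) hch _)).trans ENNReal.ofReal_add_le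
      _ = ENNReal.ofReal |c| * H (Icc (x - h) (x - 0)) +
            ENNReal.ofReal h * H (Icc (x - 2 * |c|) (x - -(2 * |c|))) := by
          rw [lintegral_add_left (measurable_indicator_sub _ _ _ _),
            lintegral_indicator_sub_Icc, lintegral_indicator_sub_Icc]
      _ ≤ ENNReal.ofReal |c| * ENNReal.ofReal (C * (h + 1)) +
            ENNReal.ofReal h * ENNReal.ofReal (C * (4 * |c| + 1)) := by
          gcongr
          · refine (hH' _ _ (by linarith)).trans (le_of_eq ?_)
            congr 2; ring
          · refine (hH' _ _ (by linarith)).trans (le_of_eq ?_)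
            congr 2; ring
      _ = ENNReal.ofReal (|c| * (C * (h + 1)) + h * (C * (4 * |c| + 1))) := by
          rw [ENNReal.ofReal_add (by positivity) (by positivity), ENNReal.ofReal_mul hc,
            ENNReal.ofReal_mul (by linarith : 0 ≤ h)]
      _ ≤ _ := by
          refine ENNReal.ofReal_le_ofReal ?_
          rw [min_eq_right (by linarith)]
          have h1 : h * |c| ≥ |c| := le_mul_of_one_le_left hc hh
          have h2 : h * |c| ≥ h := le_mul_of_one_le_right (by linarith) (by linarith)
          nlinarith

/-- One step of the telescoping sum: the increment of `E ramp h (x - S_n)` is `E X` times the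
probability that `x - S_n ∈ [0, h]`, up to the expected linearization error. -/
theorem ofReal_abs_integral_ramp_sub_le [IsProbabilityMeasure P]
    (hX : ∀ k, Measurable (X k)) (h_indep : iIndepFun X P)
    (h_id : ∀ k, IdentDistrib (X k) (X 0) P P) (h_int : Integrable (X 0) P)
    {h : ℝ} (hh : 0 ≤ h) (x : ℝ) (n : ℕ) :
    ENNReal.ofReal |∫ ω, ramp h (x - partialSum X n ω) ∂P -
        ∫ ω, ramp h (x - partialSum X (n + 1) ω) ∂P -
        (∫ ω, X 0 ω ∂P) * (P.map (partialSum X n)).real (Icc (x - h) x)| ≤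
      ∫⁻ c, ∫⁻ z, ENNReal.ofReal (rampError h (x - z) c) ∂(P.map (partialSum X n))
        ∂(P.map (X 0)) := by
  have hS := measurable_partialSum hX
  have hR := (continuous_ramp h).measurable
  have hri : ∀ k, Integrable (fun ω => ramp h (x - partialSum X k ω)) P := by
    intro k
    refine Integrable.of_bound (C := h) ?_ (ae_of_all _ fun ω => ?_)
    · have := hS k
      exact (by fun_prop : Measurable fun ω => ramp h (x - partialSum X k ω)).aestronglyMeasurable
    · rw [Real.norm_eq_abs, abs_of_nonneg (ramp_nonneg _ _)]
      exact ramp_le hh _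
  have hind : IndepFun (partialSum X n) (X n) P := by
    have := h_indep.indepFun_sum_range_succ hX n
    convert this using 1
    ext ω
    simp [partialSum]
  let g : ℝ → ℝ := fun z => (Icc 0 h).indicator 1 (x - z)
  have hg : Measurable g := by
    have : Measurable ((Icc (0 : ℝ) h).indicator (1 : ℝ → ℝ)) :=
      measurable_one.indicator measurableSet_Icc
    fun_prop
  have hXn : Integrable (X n) P := (h_id n).integrable_iff.2 h_int
  have hgi : Integrable (fun ω => X n ω * g (partialSum X n ω)) P := by
    refine hXn.mul_bdd (c := 1) ?_ (ae_of_all _ fun ω => ?_)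
    · exact (hg.comp (hS n)).aestronglyMeasurable
    · simp only [g, Set.indicator_apply, Pi.one_apply]
      split_ifs <;> simp
  have hgE : ∫ ω, X n ω * g (partialSum X n ω) ∂P =
      (∫ ω, X 0 ω ∂P) * (P.map (partialSum X n)).real (Icc (x - h) x) := by
    have h1 := (hind.comp hg measurable_id).symm.integral_fun_mul_eq_mul_integral
      (hX n).aestronglyMeasurable (hg.comp (hS n)).aestronglyMeasurable
    simp only [Function.comp_def, id] at h1
    rw [h1, (h_id n).integral_eq]
    congr 1
    rw [← integral_map (hS n).aemeasurable hg.aestronglyMeasurable]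
    have : g = (Icc (x - h) x).indicator 1 := by
      funext z
      simp only [g, Set.indicator_apply, mem_Icc, Pi.one_apply]
      congr 1
      rw [eq_iff_iff]
      constructor <;> rintro ⟨_, _⟩ <;> constructor <;> linarith
    rw [this, integral_indicator_one measurableSet_Icc]
  have hdi : Integrable (fun ω => ramp h (x - partialSum X n ω) -
      ramp h (x - partialSum X (n + 1) ω)) P := (hri n).sub (hri (n + 1))
  rw [← hgE, ← integral_sub (hri n) (hri (n + 1)), ← integral_sub hdi hgi,
    ← Real.norm_eq_abs, ofReal_norm]
  have hmE : Measurable fun p : ℝ × ℝ => ENNReal.ofReal (rampError h (x - p.1) p.2) := by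
    have := (measurable_rampError h).comp
      (by fun_prop : Measurable fun p : ℝ × ℝ => (x - p.1, p.2))
    exact this.ennreal_ofReal
  rw [← (h_id n).map_eq, ← lintegral_prod_symm' _ hmE,
    ← (indepFun_iff_map_prod_eq_prod_map_map (hS n).aemeasurable (hX n).aemeasurable).1 hind,
    lintegral_map hmE ((hS n).prodMk (hX n))]
  refine (enorm_integral_le_lintegral_enorm _).trans (le_of_eq (lintegral_congr fun ω => ?_))
  rw [← ofReal_norm, Real.norm_eq_abs]
  simp only [rampError, partialSum_succ, g]
  rw [sub_add_eq_sub_sub]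

theorem integrable_abs_mul_min {μ : Measure ℝ} (hμ : Integrable (fun c => c) μ)
    {h : ℝ} (hh : 0 ≤ h) : Integrable (fun c => |c| * min (|c| + 1) h) μ := by
  refine hμ.abs.mul_bdd (c := h) (by fun_prop) (ae_of_all _ fun c => ?_)
  rw [Real.norm_eq_abs, abs_of_nonneg (by positivity)]
  exact min_le_right _ _

/-- The approximate renewal equation obtained by summing the increments of `E ramp h (x - S_n)` over
all `n`: the sum telescopes to `ramp h x`, since the walk drifts to infinity, where the ramp
vanishes. -/
theorem abs_ramp_sub_mul_renewalMeasure_le [IsProbabilityMeasure P]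
    (hX : ∀ k, Measurable (X k)) (h_indep : iIndepFun X P)
    (h_id : ∀ k, IdentDistrib (X k) (X 0) P P) (h_int : Integrable (X 0) P)
    (h_pos : 0 < ∫ ω, X 0 ω ∂P) {C : ℝ} (hC : 0 < C)
    (hH : ∀ x r : ℝ, 0 ≤ r →
      renewalMeasure P X (Icc x (x + r)) ≤ ENNReal.ofReal (C * (r + 1)))
    {h : ℝ} (hh : 1 ≤ h) (x : ℝ) :
    |ramp h x - (∫ ω, X 0 ω ∂P) * (renewalMeasure P X).real (Icc (x - h) x)| ≤
      8 * C * ∫ c, |c| * min (|c| + 1) h ∂(P.map (X 0)) := by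
  have hS := measurable_partialSum hX
  have hh0 : 0 ≤ h := by linarith
  have hR := (continuous_ramp h).measurable
  let a : ℕ → ℝ := fun n => ∫ ω, ramp h (x - partialSum X n ω) ∂P
  let p : ℕ → ℝ := fun n => (P.map (partialSum X n)).real (Icc (x - h) x)
  have hmE : Measurable fun p : ℝ × ℝ => ENNReal.ofReal (rampError h (x - p.1) p.2) := by
    have := (measurable_rampError h).comp
      (by fun_prop : Measurable fun p : ℝ × ℝ => (x - p.1, p.2))
    exact this.ennreal_ofReal
  have hidX : Integrable (fun c => c) (P.map (X 0)) := by
    rw [← Function.id_def]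
    exact (integrable_map_measure measurable_id.aestronglyMeasurable
      (hX 0).aemeasurable).2 h_int
  have hfinite : ∀ N, |a 0 - a N - (∫ ω, X 0 ω ∂P) * ∑ n ∈ Finset.range N, p n| ≤
      8 * C * ∫ c, |c| * min (|c| + 1) h ∂(P.map (X 0)) := by
    intro N
    have hsum : a 0 - a N - (∫ ω, X 0 ω ∂P) * ∑ n ∈ Finset.range N, p n =
        ∑ n ∈ Finset.range N, (a n - a (n + 1) - (∫ ω, X 0 ω ∂P) * p n) := by
      rw [Finset.sum_sub_distrib, Finset.sum_range_sub', Finset.mul_sum]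
    have hB : 0 ≤ 8 * C * ∫ c, |c| * min (|c| + 1) h ∂(P.map (X 0)) :=
      mul_nonneg (by positivity) (integral_nonneg fun c => by positivity)
    rw [hsum]
    refine (ENNReal.ofReal_le_ofReal_iff hB).1 ?_
    calc ENNReal.ofReal |∑ n ∈ Finset.range N, (a n - a (n + 1) - (∫ ω, X 0 ω ∂P) * p n)|
        ≤ ENNReal.ofReal (∑ n ∈ Finset.range N,
            |a n - a (n + 1) - (∫ ω, X 0 ω ∂P) * p n|) :=
          ENNReal.ofReal_le_ofReal (Finset.abs_sum_le_sum_abs _ _)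
      _ = ∑ n ∈ Finset.range N,
            ENNReal.ofReal |a n - a (n + 1) - (∫ ω, X 0 ω ∂P) * p n| :=
          ENNReal.ofReal_sum_of_nonneg fun n _ => abs_nonneg _
      _ ≤ ∑ n ∈ Finset.range N, ∫⁻ c, ∫⁻ z, ENNReal.ofReal (rampError h (x - z) c)
            ∂(P.map (partialSum X n)) ∂(P.map (X 0)) :=
          Finset.sum_le_sum fun n _ =>
            ofReal_abs_integral_ramp_sub_le hX h_indep h_id h_int hh0 x n
      _ = ∫⁻ c, ∑ n ∈ Finset.range N, ∫⁻ z, ENNReal.ofReal (rampError h (x - z) c)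
            ∂(P.map (partialSum X n)) ∂(P.map (X 0)) := by
          rw [lintegral_finsetSum]
          intro n _
          exact (hmE.comp measurable_swap).lintegral_prod_right'
      _ ≤ ∫⁻ c, ∫⁻ z, ENNReal.ofReal (rampError h (x - z) c)
            ∂(renewalMeasure P X) ∂(P.map (X 0)) := by
          refine lintegral_mono fun c => ?_
          rw [renewalMeasure, lintegral_sum_measure]
          exact ENNReal.sum_le_tsum _
      _ ≤ ∫⁻ c, ENNReal.ofReal (8 * C * (|c| * min (|c| + 1) h)) ∂(P.map (X 0)) :=
          lintegral_mono fun c => lintegral_rampError_le hC hH hh x c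
      _ = ENNReal.ofReal (8 * C * ∫ c, |c| * min (|c| + 1) h ∂(P.map (X 0))) := by
          rw [← integral_const_mul, ofReal_integral_eq_lintegral_ofReal
            ((integrable_abs_mul_min hidX hh0).const_mul _)
            (ae_of_all _ fun c => by positivity)]
  have ha0 : a 0 = ramp h x := by simp [a, partialSum_zero]
  have haN : Tendsto a atTop (𝓝 0) := by
    have h0 : (0 : ℝ) = ∫ _, (0 : ℝ) ∂P := by simp
    rw [h0]
    refine tendsto_integral_of_dominated_convergence (fun _ => h) ?_ (integrable_const _) ?_ ?_
    · intro n
      have := hS n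
      exact (by fun_prop : Measurable fun ω => ramp h (x - partialSum X n ω)).aestronglyMeasurable
    · refine fun n => ae_of_all _ fun ω => ?_
      rw [Real.norm_eq_abs, abs_of_nonneg (ramp_nonneg _ _)]
      exact ramp_le hh0 _
    · filter_upwards [ae_tendsto_partialSum_atTop h_indep h_id h_int h_pos] with ω hω
      refine tendsto_const_nhds.congr' ?_
      filter_upwards [hω.eventually_ge_atTop x] with n hn
      rw [ramp_of_nonpos (by linarith)]
  have hpN : Tendsto (fun N => ∑ n ∈ Finset.range N, p n) atTop
      (𝓝 ((renewalMeasure P X).real (Icc (x - h) x))) := by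
    have h1 := ENNReal.tendsto_nat_tsum fun n => (P.map (partialSum X n)) (Icc (x - h) x)
    rw [← Measure.sum_apply _ measurableSet_Icc] at h1
    have hne : Measure.sum (fun n => P.map (partialSum X n)) (Icc (x - h) x) ≠ ⊤ := by
      have := hH (x - h) h hh0
      rw [sub_add_cancel] at this
      exact ne_top_of_le_ne_top ENNReal.ofReal_ne_top this
    have h2 := (ENNReal.tendsto_toReal hne).comp h1
    refine h2.congr fun N => ?_
    simp only [Function.comp_apply, p, Measure.real]
    exact ENNReal.toReal_sum fun n _ => measure_ne_top _ _
  have hlim := (((tendsto_const_nhds (x := a 0)).sub haN).sub (hpN.const_mul (∫ ω, X 0 ω ∂P))).abs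
  rw [sub_zero, ha0] at hlim
  refine le_of_tendsto hlim (Eventually.of_forall fun N => ?_)
  have := hfinite N
  rwa [ha0] at this

/-- Blackwell's renewal theorem at large scales: long intervals far to the right have renewal
measure close to their length divided by the mean. The error in
`abs_ramp_sub_mul_renewalMeasure_le` is `o(h)` by dominated convergence. -/
theorem exists_abs_renewalMeasure_Icc_sub_le [IsProbabilityMeasure P]
    (hX : ∀ k, Measurable (X k)) (h_indep : iIndepFun X P)
    (h_id : ∀ k, IdentDistrib (X k) (X 0) P P) (h_int : Integrable (X 0) P)
    (h_pos : 0 < ∫ ω, X 0 ω ∂P) {ε : ℝ} (hε : 0 < ε) :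
    ∃ h : ℝ, 0 < h ∧ ∀ x ≥ h,
      |(renewalMeasure P X).real (Icc (x - h) x) - h * (1 / ∫ ω, X 0 ω ∂P)| ≤ ε * h := by
  obtain ⟨C, hC, hH⟩ := exists_renewalMeasure_Icc_le hX h_indep h_id h_int h_pos
  set m := ∫ ω, X 0 ω ∂P with hm
  have hidX : Integrable (fun c => c) (P.map (X 0)) := by
    rw [← Function.id_def]
    exact (integrable_map_measure measurable_id.aestronglyMeasurable
      (hX 0).aemeasurable).2 h_int
  have hlim : Tendsto (fun h : ℝ => ∫ c, |c| * min (|c| + 1) h / h ∂(P.map (X 0))) atTop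
      (𝓝 0) := by
    have h0 : (0 : ℝ) = ∫ _, (0 : ℝ) ∂(P.map (X 0)) := by simp
    rw [h0]
    refine tendsto_integral_filter_of_dominated_convergence (fun c => |c|) ?_ ?_ hidX.abs ?_
    · exact Eventually.of_forall fun h =>
        (by fun_prop : Measurable fun c : ℝ => |c| * min (|c| + 1) h / h).aestronglyMeasurable
    · filter_upwards [eventually_gt_atTop 0] with h hh
      refine ae_of_all _ fun c => ?_
      rw [Real.norm_eq_abs, abs_of_nonneg (by positivity), div_le_iff₀ hh]
      exact mul_le_mul_of_nonneg_left (min_le_right _ _) (abs_nonneg _)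
    · refine ae_of_all _ fun c => ?_
      have h1 : Tendsto (fun h : ℝ => |c| * (|c| + 1) / h) atTop (𝓝 0) :=
        tendsto_const_nhds.div_atTop tendsto_id
      refine h1.congr' ?_
      filter_upwards [eventually_ge_atTop (|c| + 1)] with h hh
      rw [min_eq_left hh]
  have hlim2 := hlim.const_mul (8 * C)
  rw [mul_zero] at hlim2
  obtain ⟨h, hh1, hh⟩ := ((eventually_ge_atTop 1).and
    (hlim2.eventually_lt_const (mul_pos hε h_pos))).exists
  have hh0 : 0 < h := by linarith
  refine ⟨h, hh0, fun x hx => ?_⟩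
  have h1 := abs_ramp_sub_mul_renewalMeasure_le hX h_indep h_id h_int h_pos hC hH hh1 x
  rw [ramp_of_le hh0.le hx, ← hm] at h1
  rw [integral_div, ← mul_div_assoc, div_lt_iff₀ hh0] at hh
  have h2 := h1.trans hh.le
  have h3 : h - m * (renewalMeasure P X).real (Icc (x - h) x) =
      -(m * ((renewalMeasure P X).real (Icc (x - h) x) - h * (1 / m))) := by
    field_simp
    ring
  rw [h3, abs_neg, abs_mul, abs_of_pos h_pos] at h2
  refine le_of_mul_le_mul_left (h2.trans (le_of_eq ?_)) h_pos
  ring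

end Walk

/-! ### Additively slowly varying functions -/

/-- A positive measurable function `f` with `f (y + u) / f y → 1` for all `u`: the function
`y ↦ L (exp y)` for a slowly varying `L`. -/
structure IsAdditivelySlowlyVarying (f : ℝ → ℝ) : Prop where
  measurable : Measurable f
  pos : ∀ y, 0 < f y
  tendsto : ∀ u, Tendsto (fun y => f (y + u) / f y) atTop (𝓝 1)

theorem IsSlowlyVarying.comp_exp {L : ℝ → ℝ} (hL : IsSlowlyVarying L) :
    IsAdditivelySlowlyVarying fun y => L (Real.exp y) where
  measurable := hL.measurable.comp
    (Real.measurable_exp.subtype_mk (h := fun y => mem_Ioi.2 (Real.exp_pos y)))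
  pos y := hL.pos _ (Real.exp_pos y)
  tendsto u := by
    have h := (hL.tendsto (Real.exp u) (Real.exp_pos u)).comp Real.tendsto_exp_atTop
    rw [Real.rpow_zero] at h
    refine h.congr fun y => ?_
    simp only [Function.comp_apply]
    rw [← Real.exp_add, add_comm u y]

namespace IsAdditivelySlowlyVarying

variable {f : ℝ → ℝ}

/-- Averages of the oscillation of `log f` over a window vanish at infinity. The truncation at `1`
provides the dominating function. -/
theorem tendsto_integral_min_one_abs_log_sub (hf : IsAdditivelySlowlyVarying f) (a b : ℝ) :
    Tendsto (fun y => ∫ u in Ioc a b, min 1 |Real.log (f (y + u)) - Real.log (f y)|) atTop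
      (𝓝 0) := by
  have hm := hf.measurable
  have h0 : (0 : ℝ) = ∫ _ in Ioc a b, (0 : ℝ) := by simp
  rw [h0]
  refine tendsto_integral_filter_of_dominated_convergence (fun _ => 1) ?_ ?_ ?_ ?_
  · refine Eventually.of_forall fun y => Measurable.aestronglyMeasurable ?_
    fun_prop
  · refine Eventually.of_forall fun y => ae_of_all _ fun u => ?_
    rw [Real.norm_eq_abs, abs_of_nonneg (le_min zero_le_one (abs_nonneg _))]
    exact min_le_left _ _
  · simp
  · refine ae_of_all _ fun u => ?_
    have h1 := ((Real.continuousAt_log one_ne_zero).tendsto.comp (hf.tendsto u)).abs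
    rw [Real.log_one, abs_zero] at h1
    have h2 := (tendsto_const_nhds (x := (1 : ℝ))).min h1
    rw [min_eq_right zero_le_one] at h2
    refine h2.congr fun y => ?_
    simp only [Function.comp_apply]
    rw [Real.log_div (hf.pos _).ne' (hf.pos _).ne']

/-- The uniform convergence theorem for slowly varying functions. The oscillation of `log f` is
compared with its averages over windows of length `2 h`, which tend to zero by dominated
convergence. -/
theorem exists_forall_le_mul (hf : IsAdditivelySlowlyVarying f) (h : ℝ) {ε : ℝ} (hε : 0 < ε) :
    ∃ A : ℝ, 0 ≤ A ∧ ∀ y y', A ≤ y → A ≤ y' → |y - y'| ≤ h → f y' ≤ (1 + ε) * f y := by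
  have hm := hf.measurable
  wlog hh : 0 < h generalizing h
  · obtain ⟨A, hA0, hA⟩ := this 1 one_pos
    exact ⟨A, hA0, fun y y' hy hy' hyy => hA y y' hy hy' (by linarith)⟩
  let φ : ℝ → ℝ → ℝ := fun y u => min 1 |Real.log (f (y + u)) - Real.log (f y)|
  have hφ0 : ∀ y u, 0 ≤ φ y u := fun y u => le_min zero_le_one (abs_nonneg _)
  have hφi : ∀ a b y, IntegrableOn (φ y) (Ioc a b) := by
    intro a b y
    refine Measure.integrableOn_of_bounded (M := 1) (by simp) ?_ (ae_of_all _ fun u => ?_)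
    · refine Measurable.aestronglyMeasurable ?_
      fun_prop
    · rw [Real.norm_eq_abs, abs_of_nonneg (hφ0 y u)]
      exact min_le_left _ _
  set δ := min (1 / 2) (Real.log (1 + ε)) with hδ
  have hδ0 : 0 < δ := lt_min (by norm_num) (Real.log_pos (by linarith))
  obtain ⟨A, hA⟩ := eventually_atTop.1 ((hf.tendsto_integral_min_one_abs_log_sub 0
    (2 * h)).eventually_lt_const (by positivity : 0 < h * δ / 2))
  have key : ∀ y y', A ≤ y → y ≤ y' → y' ≤ y + h →
      |Real.log (f y') - Real.log (f y)| < δ := by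
    intro y y' hy hyy' hy'
    have hi : IntegrableOn (fun v => φ y (v + (y' - y))) (Ioc 0 h) := by
      have := hφi (0 + (y' - y)) (h + (y' - y)) y
      rw [← intervalIntegrable_iff_integrableOn_Ioc_of_le (by linarith)] at this ⊢
      have h3 := this.comp_add_right (y' - y)
      simpa using h3
    have h1 : h * min 1 |Real.log (f y') - Real.log (f y)| ≤
        ∫ v in Ioc 0 h, (φ y (v + (y' - y)) + φ y' v) := by
      have hconst : h * min 1 |Real.log (f y') - Real.log (f y)| =
          ∫ v in Ioc 0 h, min 1 |Real.log (f y') - Real.log (f y)| := by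
        simp [hh.le]
      rw [hconst]
      refine setIntegral_mono_on (by simp) ?_ measurableSet_Ioc fun v _ => ?_
      · exact Integrable.add hi (hφi _ _ _)
      · simp only [φ]
        have h3 : y + (v + (y' - y)) = y' + v := by ring
        rw [h3]
        have h4 := abs_sub_le (Real.log (f y')) (Real.log (f (y' + v))) (Real.log (f y))
        rw [abs_sub_comm (Real.log (f y')) (Real.log (f (y' + v)))] at h4
        have h5 := abs_nonneg (Real.log (f (y' + v)) - Real.log (f y))
        have h6 := abs_nonneg (Real.log (f (y' + v)) - Real.log (f y'))
        grind
    have h2 : ∫ v in Ioc 0 h, (φ y (v + (y' - y)) + φ y' v) ≤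
        (∫ u in Ioc 0 (2 * h), φ y u) + ∫ u in Ioc 0 (2 * h), φ y' u := by
      rw [integral_add hi (hφi _ _ _)]
      refine add_le_add ?_ ?_
      · rw [← intervalIntegral.integral_of_le hh.le,
          intervalIntegral.integral_comp_add_right (φ y) (y' - y),
          intervalIntegral.integral_of_le (by linarith)]
        refine setIntegral_mono_set (hφi _ _ _) (ae_of_all _ fun u => hφ0 y u) ?_
        exact (Ioc_subset_Ioc (by linarith) (by linarith)).eventuallyLE
      · refine setIntegral_mono_set (hφi _ _ _) (ae_of_all _ fun u => hφ0 y' u) ?_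
        exact (Ioc_subset_Ioc le_rfl (by linarith)).eventuallyLE
    have h3 := hA y hy
    have h4 := hA y' (hy.trans hyy')
    have h5 : h * min 1 |Real.log (f y') - Real.log (f y)| < h * δ := by
      have := h1.trans h2
      simp only [φ] at this
      linarith
    have h6 := lt_of_mul_lt_mul_left h5 hh.le
    have h7 : δ ≤ 1 / 2 := min_le_left _ _
    rcases min_lt_iff.1 h6 with h8 | h8
    · linarith
    · exact h8
  refine ⟨max A 0, le_max_right _ _, fun y y' hy hy' hyy => ?_⟩
  have hy := (le_max_left A 0).trans hy
  have hy' := (le_max_left A 0).trans hy'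
  have h1 : Real.log (f y') - Real.log (f y) < δ := by
    rcases le_total y y' with h2 | h2
    · exact (le_abs_self _).trans_lt (key y y' hy h2 (by linarith [neg_abs_le (y - y')]))
    · have := key y' y hy' h2 (by linarith [le_abs_self (y - y')])
      linarith [neg_abs_le (Real.log (f y) - Real.log (f y'))]
  have h2 : Real.log (f y') ≤ Real.log ((1 + ε) * f y) := by
    rw [Real.log_mul (by linarith) (hf.pos y).ne']
    linarith [min_le_right (1 / 2) (Real.log (1 + ε))]
  exact (Real.log_le_log_iff (hf.pos _) (mul_pos (by linarith) (hf.pos y))).1 h2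

/-- The primitive of a slowly varying function changes by a negligible proportion over a window of
bounded length. -/
theorem tendsto_integral_window_div (hf : IsAdditivelySlowlyVarying f)
    (hint : ∀ a b, 0 ≤ a → a ≤ b → IntervalIntegrable f volume a b)
    (hM : Tendsto (fun x => ∫ y in (0 : ℝ)..x, f y) atTop atTop) {W : ℝ} (hW : 0 ≤ W) :
    Tendsto (fun x => (∫ y in (x - W)..x, f y) / ∫ y in (0 : ℝ)..x, f y) atTop (𝓝 0) := by
  refine (nhds_basis_abs_sub_lt (0 : ℝ)).tendsto_right_iff.2 fun δ hδ => ?_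
  set K := (4 * W + 1) / δ with hK
  have hK0 : 0 < K := by positivity
  obtain ⟨A, hA0, hA⟩ := hf.exists_forall_le_mul (K + W) one_pos
  filter_upwards [eventually_ge_atTop (A + K + W), hM.eventually_gt_atTop 0] with x hx hMx
  have h1 : ∫ y in (x - W)..x, f y ≤ W * (2 * f x) := by
    have := intervalIntegral.integral_mono_on (a := x - W) (b := x) (by linarith)
      (hint _ _ (by linarith) (by linarith)) (intervalIntegrable_const (c := 2 * f x))
      (fun y hy => by
        have := hA x y (by linarith) (by linarith [hy.1])
          (abs_le.2 ⟨by linarith [hy.2], by linarith [hy.1]⟩)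
        linarith)
    rw [intervalIntegral.integral_const, smul_eq_mul, sub_sub_cancel] at this
    exact this
  have h2 : K * (f x / 2) ≤ ∫ y in (x - K)..x, f y := by
    have := intervalIntegral.integral_mono_on (a := x - K) (b := x) (by linarith)
      (intervalIntegrable_const (c := f x / 2))
      (hint _ _ (by linarith) (by linarith))
      (fun y hy => by
        have := hA y x (by linarith [hy.1]) (by linarith)
          (abs_le.2 ⟨by linarith [hy.1], by linarith [hy.2]⟩)
        linarith)
    rw [intervalIntegral.integral_const, smul_eq_mul, sub_sub_cancel] at this
    exact this
  have h3 : ∫ y in (x - K)..x, f y ≤ ∫ y in (0 : ℝ)..x, f y := by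
    rw [← intervalIntegral.integral_add_adjacent_intervals (b := x - K)
      (hint 0 (x - K) le_rfl (by linarith)) (hint (x - K) x (by linarith) (by linarith))]
    have := intervalIntegral.integral_nonneg (μ := volume) (f := f) (a := 0) (b := x - K)
      (by linarith) (fun y _ => (hf.pos y).le)
    linarith
  have h4 : 0 ≤ ∫ y in (x - W)..x, f y :=
    intervalIntegral.integral_nonneg (by linarith) (fun y _ => (hf.pos y).le)
  rw [sub_zero, abs_of_nonneg (by positivity), div_lt_iff₀ hMx]
  have h5 : K * δ = 4 * W + 1 := by rw [hK]; field_simp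
  have h6 := mul_le_mul_of_nonneg_left (h2.trans h3) hδ.le
  have h7 : δ * (K * (f x / 2)) = (4 * W + 1) * (f x / 2) := by rw [← h5]; ring
  rw [h7] at h6
  have := hf.pos x
  linarith

end IsAdditivelySlowlyVarying

/-! ### Convolution of a slowly varying function with the renewal measure -/

/-- Tonelli's theorem on the strip `z ≤ w ≤ z + h`. -/
theorem lintegral_strip_swap {H : Measure ℝ} [SFinite H] {g : ℝ → ENNReal} (hg : Measurable g)
    (h : ℝ) (S T : Set ℝ) :
    ∫⁻ z in S, (∫⁻ w in T, (Icc z (z + h)).indicator g w) ∂H =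
      ∫⁻ w in T, g w * H.restrict S (Icc (w - h) w) := by
  have hset : MeasurableSet {p : ℝ × ℝ | p.2 ∈ Icc p.1 (p.1 + h)} := by
    have : {p : ℝ × ℝ | p.2 ∈ Icc p.1 (p.1 + h)} = {p | p.1 ≤ p.2} ∩ {p | p.2 ≤ p.1 + h} := by
      ext p; simp
    rw [this]
    exact (measurableSet_le (by fun_prop) (by fun_prop)).inter
      (measurableSet_le (by fun_prop) (by fun_prop))
  have hmeas : Measurable (Function.uncurry fun z w => (Icc z (z + h)).indicator g w) :=
    (hg.comp measurable_snd).indicator hset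
  rw [lintegral_lintegral_swap hmeas.aemeasurable]
  refine lintegral_congr fun w => ?_
  have : ∀ z, (Icc z (z + h)).indicator g w = (Icc (w - h) w).indicator (fun _ => g w) z := by
    intro z
    simp only [Set.indicator_apply, mem_Icc]
    congr 1
    rw [eq_iff_iff]
    constructor <;> rintro ⟨_, _⟩ <;> constructor <;> linarith
  simp_rw [this]
  rw [lintegral_indicator_const measurableSet_Icc]

namespace IsAdditivelySlowlyVarying

variable {f : ℝ → ℝ}

theorem setLIntegral_Ioc_sub (hf : IsAdditivelySlowlyVarying f)
    (hint : ∀ a b, 0 ≤ a → a ≤ b → IntervalIntegrable f volume a b)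
    {a b x : ℝ} (hab : a ≤ b) (hbx : b ≤ x) :
    ∫⁻ w in Ioc a b, ENNReal.ofReal (f (x - w)) =
      ENNReal.ofReal (∫ y in (x - b)..(x - a), f y) := by
  have hi := hint (x - b) (x - a) (by linarith) (by linarith)
  have h1 : IntervalIntegrable (fun w => f (x - w)) volume a b := by
    have := (hi.comp_sub_left x).symm
    simpa using this
  rw [← ofReal_integral_eq_lintegral_ofReal
    ((intervalIntegrable_iff_integrableOn_Ioc_of_le hab).1 h1)
    (ae_of_all _ fun w => (hf.pos _).le), ← intervalIntegral.integral_of_le hab,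
    intervalIntegral.integral_comp_sub_left]

/-- Upper half of the smoothing argument: away from the right end point, `f (x - z)` is compared
with the average of `f (x - w)` over `w ∈ [z, z + h]`. -/
theorem lintegral_le_lintegral_mul_measure_Icc (hf : IsAdditivelySlowlyVarying f)
    {H : Measure ℝ} [SFinite H] {h ε A : ℝ} (hε : 0 < ε) (hA0 : 0 ≤ A) (hh : 0 < h)
    (hA : ∀ y y', A ≤ y → A ≤ y' → |y - y'| ≤ h → f y' ≤ (1 + ε) * f y) (x : ℝ) :
    ENNReal.ofReal h * ∫⁻ z in Ioc 0 (x - (A + h)), ENNReal.ofReal (f (x - z)) ∂H ≤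
      ENNReal.ofReal (1 + ε) *
        ∫⁻ w in Ioc 0 x, ENNReal.ofReal (f (x - w)) * H (Icc (w - h) w) := by
  have hm := hf.measurable
  have hg : Measurable fun w => ENNReal.ofReal (f (x - w)) := by fun_prop
  calc ENNReal.ofReal h * ∫⁻ z in Ioc 0 (x - (A + h)), ENNReal.ofReal (f (x - z)) ∂H
      = ∫⁻ z in Ioc 0 (x - (A + h)), ENNReal.ofReal h * ENNReal.ofReal (f (x - z)) ∂H := by
        rw [lintegral_const_mul _ hg]
    _ ≤ ∫⁻ z in Ioc 0 (x - (A + h)), ENNReal.ofReal (1 + ε) * (∫⁻ w in Ioc 0 x,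
          (Icc z (z + h)).indicator (fun w => ENNReal.ofReal (f (x - w))) w) ∂H := by
        refine setLIntegral_mono' measurableSet_Ioc fun z hz => ?_
        have hsub : Icc z (z + h) ⊆ Ioc 0 x := fun w hw =>
          ⟨by linarith [hz.1, hw.1], by linarith [hz.2, hw.2]⟩
        rw [setLIntegral_indicator measurableSet_Icc, inter_eq_left.2 hsub,
          ← lintegral_const_mul _ hg]
        have hconst : ENNReal.ofReal h * ENNReal.ofReal (f (x - z)) =
            ∫⁻ _ in Icc z (z + h), ENNReal.ofReal (f (x - z)) := by
          rw [setLIntegral_const, Real.volume_Icc, add_sub_cancel_left, mul_comm]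
        rw [hconst]
        refine setLIntegral_mono' measurableSet_Icc fun w hw => ?_
        rw [← ENNReal.ofReal_mul (by linarith)]
        refine ENNReal.ofReal_le_ofReal (hA _ _ ?_ ?_ ?_)
        · linarith [hz.2, hw.2]
        · linarith [hz.2]
        · exact abs_le.2 ⟨by linarith [hw.2], by linarith [hw.1]⟩
    _ ≤ ENNReal.ofReal (1 + ε) * ∫⁻ z in Ioc 0 (x - (A + h)), (∫⁻ w in Ioc 0 x,
          (Icc z (z + h)).indicator (fun w => ENNReal.ofReal (f (x - w))) w) ∂H := by
        rw [lintegral_const_mul' _ _ ENNReal.ofReal_ne_top]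
    _ ≤ _ := by
        rw [lintegral_strip_swap hg]
        gcongr
        exact Measure.restrict_le_self

/-- Lower half of the smoothing argument. -/
theorem lintegral_mul_measure_Icc_le_lintegral (hf : IsAdditivelySlowlyVarying f)
    {H : Measure ℝ} [SFinite H] {h ε A : ℝ} (hε : 0 < ε) (hA0 : 0 ≤ A) (hh : 0 < h)
    (hA : ∀ y y', A ≤ y → A ≤ y' → |y - y'| ≤ h → f y' ≤ (1 + ε) * f y) (x : ℝ) :
    ∫⁻ w in Ioc h (x - A), ENNReal.ofReal (f (x - w)) * H (Icc (w - h) w) ≤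
      ENNReal.ofReal ((1 + ε) * h) * ∫⁻ z in Ioc 0 x, ENNReal.ofReal (f (x - z)) ∂H := by
  have hm := hf.measurable
  have hg : Measurable fun w => ENNReal.ofReal (f (x - w)) := by fun_prop
  calc ∫⁻ w in Ioc h (x - A), ENNReal.ofReal (f (x - w)) * H (Icc (w - h) w)
      = ∫⁻ w in Ioc h (x - A), ENNReal.ofReal (f (x - w)) *
          H.restrict (Ioc 0 (x - A)) (Icc (w - h) w) := by
        refine setLIntegral_congr_fun measurableSet_Ioc fun w hw => ?_
        have hsub : Icc (w - h) w ⊆ Ioc 0 (x - A) := fun z hz =>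
          ⟨by linarith [hw.1, hz.1], by linarith [hw.2, hz.2]⟩
        rw [Measure.restrict_apply measurableSet_Icc, inter_eq_left.2 hsub]
    _ = ∫⁻ z in Ioc 0 (x - A), (∫⁻ w in Ioc h (x - A),
          (Icc z (z + h)).indicator (fun w => ENNReal.ofReal (f (x - w))) w) ∂H :=
        (lintegral_strip_swap hg _ _ _).symm
    _ ≤ ∫⁻ z in Ioc 0 (x - A), ENNReal.ofReal ((1 + ε) * h) * ENNReal.ofReal (f (x - z)) ∂H := by
        refine setLIntegral_mono' measurableSet_Ioc fun z hz => ?_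
        have hconst : ENNReal.ofReal ((1 + ε) * h) * ENNReal.ofReal (f (x - z)) =
            ∫⁻ w, (Icc z (z + h)).indicator
              (fun _ => ENNReal.ofReal ((1 + ε) * f (x - z))) w := by
          rw [lintegral_indicator_const measurableSet_Icc, Real.volume_Icc, add_sub_cancel_left,
            ENNReal.ofReal_mul (by linarith), ENNReal.ofReal_mul (by linarith)]
          ring
        rw [hconst, ← lintegral_indicator measurableSet_Ioc]
        refine lintegral_mono fun w => ?_
        by_cases hw : w ∈ Ioc h (x - A)
        · rw [Set.indicator_of_mem hw]
          by_cases hwz : w ∈ Icc z (z + h)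
          · rw [Set.indicator_of_mem hwz, Set.indicator_of_mem hwz]
            refine ENNReal.ofReal_le_ofReal (hA _ _ ?_ ?_ ?_)
            · linarith [hz.2]
            · linarith [hw.2]
            · exact abs_le.2 ⟨by linarith [hwz.1], by linarith [hwz.2]⟩
          · rw [Set.indicator_of_notMem hwz]
            exact zero_le
        · rw [Set.indicator_of_notMem hw]
          exact zero_le
    _ = ENNReal.ofReal ((1 + ε) * h) *
          ∫⁻ z in Ioc 0 (x - A), ENNReal.ofReal (f (x - z)) ∂H := lintegral_const_mul _ hg
    _ ≤ _ := by
        gcongr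
        linarith

end IsAdditivelySlowlyVarying

namespace IsAdditivelySlowlyVarying

variable {f : ℝ → ℝ}

theorem intervalIntegrable (hf : IsAdditivelySlowlyVarying f)
    (hbdd : ∀ b, ∃ B, ∀ y ∈ Icc 0 b, f y ≤ B) (a b : ℝ) (ha : 0 ≤ a) (hab : a ≤ b) :
    IntervalIntegrable f volume a b := by
  obtain ⟨B, hB⟩ := hbdd b
  rw [intervalIntegrable_iff_integrableOn_Ioc_of_le hab]
  refine Measure.integrableOn_of_bounded (M := B) (by simp) hf.measurable.aestronglyMeasurable ?_
  refine (ae_restrict_iff' measurableSet_Ioc).2 (ae_of_all _ fun y hy => ?_)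
  rw [Real.norm_eq_abs, abs_of_pos (hf.pos y)]
  exact hB y ⟨by linarith [hy.1], hy.2⟩

theorem integrableOn_comp_sub (hf : IsAdditivelySlowlyVarying f)
    (hbdd : ∀ b, ∃ B, ∀ y ∈ Icc 0 b, f y ≤ B) {H : Measure ℝ}
    (hH : ∀ a b : ℝ, H (Icc a b) ≠ ⊤) (x : ℝ) :
    IntegrableOn (fun z => f (x - z)) (Ioc 0 x) H := by
  obtain ⟨B, hB⟩ := hbdd x
  have hm := hf.measurable
  refine Measure.integrableOn_of_bounded (M := B)
    (ne_top_of_le_ne_top (hH 0 x) (measure_mono Ioc_subset_Icc_self))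
    (hm.comp (measurable_const.sub measurable_id)).aestronglyMeasurable ?_
  refine (ae_restrict_iff' measurableSet_Ioc).2 (ae_of_all _ fun z hz => ?_)
  rw [Real.norm_eq_abs, abs_of_pos (hf.pos _)]
  exact hB _ ⟨by linarith [hz.2], by linarith [hz.1]⟩

/-- If the measure `H` gives uniformly bounded mass to unit intervals and has density close to `κ`
on the scale `h` far to the right, its convolution with `f` is at most about `κ` times the
primitive of `f`. -/
theorem exists_integral_le (hf : IsAdditivelySlowlyVarying f)
    (hbdd : ∀ b, ∃ B, ∀ y ∈ Icc 0 b, f y ≤ B) {H : Measure ℝ} [SFinite H] {C : ℝ} (hC : 0 < C)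
    (hH : ∀ x r : ℝ, 0 ≤ r → H (Icc x (x + r)) ≤ ENNReal.ofReal (C * (r + 1)))
    (htop : ∀ a b : ℝ, H (Icc a b) ≠ ⊤) {κ ε h : ℝ} (hκ : 0 < κ) (hε : 0 < ε) (hh : 0 < h)
    (hblack : ∀ x ≥ h, H.real (Icc (x - h) x) ≤ h * (κ + ε)) :
    ∃ K X : ℝ, ∀ x ≥ X, h * ∫ z in Ioc 0 x, f (x - z) ∂H ≤
      (1 + ε) * (C * (h + 1) * (∫ y in (x - h)..x, f y) +
        h * (κ + ε) * ∫ y in (0 : ℝ)..x, f y) + K := by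
  have hint := hf.intervalIntegrable hbdd
  have hm := hf.measurable
  obtain ⟨A, hA0, hA⟩ := hf.exists_forall_le_mul h hε
  obtain ⟨B, hB⟩ := hbdd (A + h)
  have hB0 : 0 ≤ B := (hf.pos 0).le.trans (hB 0 ⟨le_rfl, by linarith⟩)
  refine ⟨h * (B * (C * (A + h + 1))), A + h, fun x hx => ?_⟩
  have hconv := hf.integrableOn_comp_sub hbdd htop x
  have hM0 : 0 ≤ ∫ y in (0 : ℝ)..x, f y :=
    intervalIntegral.integral_nonneg (by linarith) fun y _ => (hf.pos y).le
  have hW0 : 0 ≤ ∫ y in (x - h)..x, f y :=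
    intervalIntegral.integral_nonneg (by linarith) fun y _ => (hf.pos y).le
  have hsplit : ∫ z in Ioc 0 x, f (x - z) ∂H =
      (∫ z in Ioc 0 (x - (A + h)), f (x - z) ∂H) + ∫ z in Ioc (x - (A + h)) x, f (x - z) ∂H := by
    rw [← setIntegral_union (Ioc_disjoint_Ioc_of_le le_rfl) measurableSet_Ioc
      (hconv.mono_set (Ioc_subset_Ioc le_rfl (by linarith)))
      (hconv.mono_set (Ioc_subset_Ioc (by linarith) le_rfl)),
      Ioc_union_Ioc_eq_Ioc (by linarith) (by linarith)]
  have hend : ∫ z in Ioc (x - (A + h)) x, f (x - z) ∂H ≤ B * (C * (A + h + 1)) := by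
    have hfin : H (Ioc (x - (A + h)) x) ≠ ⊤ :=
      ne_top_of_le_ne_top (htop _ _) (measure_mono Ioc_subset_Icc_self)
    calc ∫ z in Ioc (x - (A + h)) x, f (x - z) ∂H
        ≤ ∫ _ in Ioc (x - (A + h)) x, B ∂H := by
          refine setIntegral_mono_on (hconv.mono_set (Ioc_subset_Ioc (by linarith) le_rfl))
            (integrableOn_const hfin) measurableSet_Ioc fun z hz => ?_
          exact hB _ ⟨by linarith [hz.2], by linarith [hz.1]⟩
      _ = H.real (Ioc (x - (A + h)) x) * B := by
          rw [setIntegral_const, smul_eq_mul]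
      _ ≤ (C * (A + h + 1)) * B := by
          gcongr
          refine ENNReal.toReal_le_of_le_ofReal (by positivity) ?_
          refine (measure_mono Ioc_subset_Icc_self).trans ?_
          have := hH (x - (A + h)) (A + h) (by linarith)
          rwa [sub_add_cancel] at this
      _ = _ := mul_comm _ _
  have hmain : h * ∫ z in Ioc 0 (x - (A + h)), f (x - z) ∂H ≤
      (1 + ε) * (C * (h + 1) * (∫ y in (x - h)..x, f y) +
        h * (κ + ε) * ∫ y in (0 : ℝ)..x, f y) := by
    refine (ENNReal.ofReal_le_ofReal_iff (by positivity)).1 ?_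
    rw [ENNReal.ofReal_mul hh.le, ofReal_integral_eq_lintegral_ofReal
      (hconv.mono_set (Ioc_subset_Ioc le_rfl (by linarith)))
      (ae_of_all _ fun z => (hf.pos _).le)]
    refine (hf.lintegral_le_lintegral_mul_measure_Icc hε hA0 hh hA x).trans ?_
    rw [ENNReal.ofReal_mul (by linarith)]
    gcongr
    have hmeas : Measurable fun w => ENNReal.ofReal (f (x - w)) := by fun_prop
    calc ∫⁻ w in Ioc 0 x, ENNReal.ofReal (f (x - w)) * H (Icc (w - h) w)
        = (∫⁻ w in Ioc 0 h, ENNReal.ofReal (f (x - w)) * H (Icc (w - h) w)) +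
            ∫⁻ w in Ioc h x, ENNReal.ofReal (f (x - w)) * H (Icc (w - h) w) := by
          rw [← lintegral_union measurableSet_Ioc (Ioc_disjoint_Ioc_of_le le_rfl),
            Ioc_union_Ioc_eq_Ioc hh.le (by linarith)]
      _ ≤ (∫⁻ w in Ioc 0 h, ENNReal.ofReal (f (x - w)) * ENNReal.ofReal (C * (h + 1))) +
            ∫⁻ w in Ioc h x, ENNReal.ofReal (f (x - w)) * ENNReal.ofReal (h * (κ + ε)) := by
          refine add_le_add ?_ ?_
          · refine lintegral_mono fun w => ?_
            gcongr
            have := hH (w - h) h hh.le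
            rwa [sub_add_cancel] at this
          · refine setLIntegral_mono' measurableSet_Ioc fun w hw => ?_
            gcongr
            rw [ENNReal.le_ofReal_iff_toReal_le (htop _ _) (by positivity)]
            exact hblack w hw.1.le
      _ ≤ (∫⁻ w in Ioc 0 h, ENNReal.ofReal (f (x - w)) * ENNReal.ofReal (C * (h + 1))) +
            ∫⁻ w in Ioc 0 x, ENNReal.ofReal (f (x - w)) * ENNReal.ofReal (h * (κ + ε)) := by
          gcongr
      _ = _ := by
          rw [lintegral_mul_const _ hmeas, lintegral_mul_const _ hmeas,
            hf.setLIntegral_Ioc_sub hint hh.le (by linarith),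
            hf.setLIntegral_Ioc_sub hint (by linarith : (0 : ℝ) ≤ x) le_rfl, sub_zero, sub_self,
            ← ENNReal.ofReal_mul hW0, ← ENNReal.ofReal_mul hM0,
            ← ENNReal.ofReal_add (by positivity) (by positivity)]
          congr 1
          ring
  rw [hsplit, mul_add]
  exact add_le_add hmain (mul_le_mul_of_nonneg_left hend hh.le)

/-- The lower bound matching `exists_integral_le`. -/
theorem exists_le_integral (hf : IsAdditivelySlowlyVarying f)
    (hbdd : ∀ b, ∃ B, ∀ y ∈ Icc 0 b, f y ≤ B) {H : Measure ℝ} [SFinite H]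
    (htop : ∀ a b : ℝ, H (Icc a b) ≠ ⊤)
    {κ ε h : ℝ} (hε : 0 < ε) (hεκ : ε ≤ κ) (hh : 0 < h)
    (hblack : ∀ x ≥ h, h * (κ - ε) ≤ H.real (Icc (x - h) x)) :
    ∃ K X : ℝ, ∀ x ≥ X,
      (κ - ε) * ((∫ y in (0 : ℝ)..x, f y) - (∫ y in (x - h)..x, f y) - K) ≤
        (1 + ε) * ∫ z in Ioc 0 x, f (x - z) ∂H := by
  have hint := hf.intervalIntegrable hbdd
  have hm := hf.measurable
  obtain ⟨A, hA0, hA⟩ := hf.exists_forall_le_mul h hε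
  refine ⟨∫ y in (0 : ℝ)..A, f y, A + h, fun x hx => ?_⟩
  have hconv := hf.integrableOn_comp_sub hbdd htop x
  have hI0 : 0 ≤ ∫ z in Ioc 0 x, f (x - z) ∂H := integral_nonneg fun z => (hf.pos _).le
  have hsplit : (∫ y in (0 : ℝ)..x, f y) - (∫ y in (x - h)..x, f y) - (∫ y in (0 : ℝ)..A, f y) =
      ∫ y in A..(x - h), f y := by
    have h1 := intervalIntegral.integral_add_adjacent_intervals
      (hint 0 A le_rfl hA0) (hint A (x - h) hA0 (by linarith))
    have h2 := intervalIntegral.integral_add_adjacent_intervals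
      (hint 0 (x - h) le_rfl (by linarith)) (hint (x - h) x (by linarith) (by linarith))
    linarith
  have hJ0 : 0 ≤ ∫ y in A..(x - h), f y :=
    intervalIntegral.integral_nonneg (by linarith) fun y _ => (hf.pos y).le
  rw [hsplit]
  have hmeas : Measurable fun w => ENNReal.ofReal (f (x - w)) := by fun_prop
  have hκε : 0 ≤ κ - ε := by linarith
  have key : (∫ y in A..(x - h), f y) * (h * (κ - ε)) ≤
      (1 + ε) * h * ∫ z in Ioc 0 x, f (x - z) ∂H := by
    refine (ENNReal.ofReal_le_ofReal_iff (by positivity)).1 ?_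
    rw [ENNReal.ofReal_mul (by positivity : 0 ≤ (1 + ε) * h), ofReal_integral_eq_lintegral_ofReal
      hconv (ae_of_all _ fun z => (hf.pos _).le)]
    refine le_trans ?_ (hf.lintegral_mul_measure_Icc_le_lintegral hε hA0 hh hA x)
    have h1 := hf.setLIntegral_Ioc_sub hint (by linarith : h ≤ x - A)
      (by linarith : x - A ≤ x)
    rw [sub_sub_cancel] at h1
    rw [ENNReal.ofReal_mul hJ0, ← h1, ← lintegral_mul_const _ hmeas]
    refine setLIntegral_mono' measurableSet_Ioc fun w hw => ?_
    gcongr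
    rw [ENNReal.ofReal_le_iff_le_toReal (htop _ _)]
    exact hblack w hw.1.le
  refine le_of_mul_le_mul_left ?_ hh
  linarith

/-- The convolution of a slowly varying function with a measure whose density at large scales
tends to `κ` is asymptotic to `κ` times the primitive of the function. -/
theorem tendsto_integral_div (hf : IsAdditivelySlowlyVarying f)
    (hbdd : ∀ b, ∃ B, ∀ y ∈ Icc 0 b, f y ≤ B)
    (hM : Tendsto (fun x => ∫ y in (0 : ℝ)..x, f y) atTop atTop)
    {H : Measure ℝ} [SFinite H] {C : ℝ} (hC : 0 < C)
    (hH : ∀ x r : ℝ, 0 ≤ r → H (Icc x (x + r)) ≤ ENNReal.ofReal (C * (r + 1)))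
    (htop : ∀ a b : ℝ, H (Icc a b) ≠ ⊤) {κ : ℝ} (hκ : 0 < κ)
    (hblack : ∀ ε : ℝ, 0 < ε → ∃ h : ℝ, 0 < h ∧ ∀ x ≥ h,
      |H.real (Icc (x - h) x) - h * κ| ≤ ε * h) :
    Tendsto (fun x => (∫ z in Ioc 0 x, f (x - z) ∂H) / ∫ y in (0 : ℝ)..x, f y) atTop (𝓝 κ) := by
  have hint := hf.intervalIntegrable hbdd
  have hwin := fun {h : ℝ} (hh : 0 ≤ h) => hf.tendsto_integral_window_div hint hM hh
  have hconst : ∀ K : ℝ, Tendsto (fun x => K / ∫ y in (0 : ℝ)..x, f y) atTop (𝓝 0) :=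
    fun K => tendsto_const_nhds.div_atTop hM
  refine tendsto_order.2 ⟨fun a ha => ?_, fun a ha => ?_⟩
  · obtain ⟨ε, hε1, hε, hεκ⟩ : ∃ ε : ℝ, a < (κ - ε) / (1 + ε) ∧ 0 < ε ∧ ε < κ := by
      have h1 : Tendsto (fun ε : ℝ => (κ - ε) / (1 + ε)) (𝓝[>] 0) (𝓝 ((κ - 0) / (1 + 0))) := by
        refine Tendsto.mono_left ?_ nhdsWithin_le_nhds
        exact ContinuousAt.tendsto (by fun_prop (disch := norm_num))
      rw [sub_zero, add_zero, div_one] at h1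
      exact ((h1.eventually_const_lt ha).and (Ioo_mem_nhdsGT hκ)).exists
    obtain ⟨h, hh, hhb⟩ := hblack ε hε
    obtain ⟨K, X, hKX⟩ := hf.exists_le_integral hbdd htop hε hεκ.le hh
      (fun x hx => by have := (abs_le.1 (hhb x hx)).1; linarith)
    have hlim := ((((tendsto_const_nhds (x := (1 : ℝ))).sub (hwin hh.le)).sub
      (hconst K)).const_mul ((κ - ε) / (1 + ε)))
    rw [sub_zero, sub_zero, mul_one] at hlim
    filter_upwards [hlim.eventually_const_lt hε1, eventually_ge_atTop X,
      hM.eventually_gt_atTop 0] with x h1 h2 h3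
    refine h1.trans_le ?_
    have h4 := hKX x h2
    have h5 : (0 : ℝ) < 1 + ε := by linarith
    rw [le_div_iff₀ h3]
    refine le_of_mul_le_mul_left ?_ h5
    refine le_trans (le_of_eq ?_) h4
    field_simp
  · obtain ⟨ε, hε1, hε⟩ : ∃ ε : ℝ, (1 + ε) * (κ + ε) < a ∧ 0 < ε := by
      have h1 : Tendsto (fun ε : ℝ => (1 + ε) * (κ + ε)) (𝓝[>] 0) (𝓝 ((1 + 0) * (κ + 0))) := by
        refine Tendsto.mono_left ?_ nhdsWithin_le_nhds
        exact ContinuousAt.tendsto (by fun_prop)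
      rw [add_zero, add_zero, one_mul] at h1
      exact ((h1.eventually_lt_const ha).and self_mem_nhdsWithin).exists
    obtain ⟨h, hh, hhb⟩ := hblack ε hε
    obtain ⟨K, X, hKX⟩ := hf.exists_integral_le hbdd hC hH htop hκ hε hh
      (fun x hx => by have := (abs_le.1 (hhb x hx)).2; linarith)
    have hlim := ((((hwin hh.le).const_mul (C * (h + 1) / h)).add_const (κ + ε)).const_mul
      (1 + ε)).add (hconst (K / h))
    rw [mul_zero, zero_add, add_zero] at hlim
    filter_upwards [hlim.eventually_lt_const hε1, eventually_ge_atTop X,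
      hM.eventually_gt_atTop 0] with x h1 h2 h3
    refine lt_of_le_of_lt ?_ h1
    have h4 := hKX x h2
    rw [div_le_iff₀ h3]
    refine le_of_mul_le_mul_left ?_ hh
    refine h4.trans (le_of_eq ?_)
    field_simp

end IsAdditivelySlowlyVarying

/-! ### From additive to multiplicative scale -/

theorem LocallyBoundedOn.exists_comp_exp_le {L : ℝ → ℝ} (hL : LocallyBoundedOn L (Ici 1)) (b : ℝ) :
    ∃ B, ∀ y ∈ Icc 0 b, L (Real.exp y) ≤ B := by
  have h := hL (Icc 1 (Real.exp b)) Icc_subset_Ici_self isCompact_Icc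
  obtain ⟨B, hB⟩ := h.bddAbove
  refine ⟨B, fun y hy => hB ⟨Real.exp y, ⟨?_, ?_⟩, rfl⟩⟩
  · exact Real.one_le_exp hy.1
  · exact Real.exp_le_exp.2 hy.2

theorem exp_image_Ioc (b : ℝ) : Real.exp '' Ioc 0 b = Ioc 1 (Real.exp b) := by
  ext t
  constructor
  · rintro ⟨y, hy, rfl⟩
    exact ⟨Real.one_lt_exp_iff.2 hy.1, Real.exp_le_exp.2 hy.2⟩
  · intro ht
    have ht0 : 0 < t := by linarith [ht.1]
    exact ⟨Real.log t, ⟨Real.log_pos ht.1, (Real.log_le_iff_le_exp ht0).2 ht.2⟩,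
      Real.exp_log ht0⟩

theorem integral_inv_mul_exp (L : ℝ → ℝ) {b : ℝ} (hb : 0 ≤ b) :
    ∫ t in (1 : ℝ)..Real.exp b, t⁻¹ * L t = ∫ y in (0 : ℝ)..b, L (Real.exp y) := by
  rw [intervalIntegral.integral_of_le (Real.one_le_exp hb), ← exp_image_Ioc,
    integral_image_eq_integral_abs_deriv_smul measurableSet_Ioc
      (fun x _ => (Real.hasDerivAt_exp x).hasDerivWithinAt) Real.exp_injective.injOn,
    intervalIntegral.integral_of_le hb]
  refine integral_congr_ae (ae_of_all _ fun y => ?_)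
  simp only [smul_eq_mul, abs_of_pos (Real.exp_pos y)]
  rw [mul_inv_cancel_left₀ (Real.exp_pos y).ne']

theorem intervalIntegrable_inv_mul_exp {L : ℝ → ℝ} {b : ℝ} (hb : 0 ≤ b)
    (h : IntervalIntegrable (fun y => L (Real.exp y)) volume 0 b) :
    IntervalIntegrable (fun t => t⁻¹ * L t) volume 1 (Real.exp b) := by
  rw [intervalIntegrable_iff_integrableOn_Ioc_of_le (Real.one_le_exp hb), ← exp_image_Ioc,
    integrableOn_image_iff_integrableOn_abs_deriv_smul measurableSet_Ioc
      (fun x _ => (Real.hasDerivAt_exp x).hasDerivWithinAt) Real.exp_injective.injOn]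
  refine ((intervalIntegrable_iff_integrableOn_Ioc_of_le hb).1 h).congr
    (ae_of_all _ fun y => ?_)
  simp only [smul_eq_mul, abs_of_pos (Real.exp_pos y)]
  rw [mul_inv_cancel_left₀ (Real.exp_pos y).ne']

/-- After the substitution `t = exp y`, changing the base point `x₀` to `1` only adds a constant. -/
theorem exists_deHaan_exp_eq {L : ℝ → ℝ} {x₀ : ℝ}
    (hint : ∀ b, 0 ≤ b → IntervalIntegrable (fun y => L (Real.exp y)) volume 0 b)
    (h_fin : ∀ x : ℝ, x₀ < x → IntegrableOn (fun t : ℝ => t⁻¹ * L t) (Ioc x₀ x) volume) :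
    ∃ K : ℝ, ∀ x, 0 ≤ x →
      deHaan L x₀ (Real.exp x) = K + ∫ y in (0 : ℝ)..x, L (Real.exp y) := by
  have h01 : IntervalIntegrable (fun t => t⁻¹ * L t) volume x₀ 1 := by
    rcases lt_or_ge x₀ 1 with h | h
    · exact (intervalIntegrable_iff_integrableOn_Ioc_of_le h.le).2 (h_fin 1 h)
    · have := intervalIntegrable_inv_mul_exp (Real.log_nonneg h) (hint _ (Real.log_nonneg h))
      rw [Real.exp_log (by linarith)] at this
      exact this.symm
  refine ⟨∫ t in x₀..1, t⁻¹ * L t, fun x hx => ?_⟩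
  rw [deHaan, ← integral_inv_mul_exp L hx, intervalIntegral.integral_add_adjacent_intervals h01
    (intervalIntegrable_inv_mul_exp hx (hint x hx))]

/-- Almost everywhere equal increments have the same renewal measure. -/
theorem renewalMeasure_congr {Ω : Type*} [MeasurableSpace Ω] {P : Measure Ω} {X Y : ℕ → Ω → ℝ}
    (h : ∀ k, X k =ᵐ[P] Y k) : renewalMeasure P X = renewalMeasure P Y := by
  unfold renewalMeasure
  congr 1
  funext n
  refine Measure.map_congr ?_
  filter_upwards [ae_all_iff.2 h] with ω hω
  simp [partialSum, hω]

end Renewal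

theorem theorem3p1 {Ω Ω' : Type*} [MeasurableSpace Ω] [MeasurableSpace Ω']
    (P : Measure Ω) [IsProbabilityMeasure P] (P' : Measure Ω') [IsProbabilityMeasure P']
    -- the generic increment `Z`, with finite positive mean and non-arithmetic law
    (Z : Ω' → ℝ) (hZ_int : Integrable Z P') (hZ_pos : 0 < ∫ ω, Z ω ∂P')
    (hZ_law : ¬ Renewal.IsArithmetic (P'.map Z))
    -- a sequence of independent copies of `Z`
    (Zs : ℕ → Ω → ℝ) (h_indep : iIndepFun Zs P) (h_copy : ∀ k, IdentDistrib (Zs k) Z P P')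
    (L : ℝ → ℝ) (hL : Renewal.IsSlowlyVarying L)
    (hL_bdd : Renewal.LocallyBoundedOn L (Ici 1))
    (x₀ : ℝ) (hx₀ : 0 ≤ x₀)
    (h_fin : ∀ x : ℝ, x₀ < x → IntegrableOn (fun t : ℝ => t⁻¹ * L t) (Ioc x₀ x) volume)
    (h_inf : Tendsto (fun x : ℝ => Renewal.deHaan L x₀ x) atTop atTop) :
    (∀ x : ℝ, IntegrableOn (fun z : ℝ => L (Real.exp (x - z))) (Ioc 0 x)
      (Renewal.renewalMeasure P Zs)) ∧
    Tendsto
      (fun x : ℝ =>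
        (∫ z in Ioc 0 x, L (Real.exp (x - z)) ∂(Renewal.renewalMeasure P Zs)) /
          ((1 / ∫ ω, Z ω ∂P') * Renewal.deHaan L x₀ (Real.exp x)))
      atTop (𝓝 1) := by
  -- replace the increments by measurable versions
  let X : ℕ → Ω → ℝ := fun k => (h_copy k).aemeasurable_fst.mk
  have hZX : ∀ k, Zs k =ᵐ[P] X k := fun k => (h_copy k).aemeasurable_fst.ae_eq_mk
  have hX : ∀ k, Measurable (X k) := fun k => (h_copy k).aemeasurable_fst.measurable_mk
  have hX_indep : iIndepFun X P := h_indep.congr hZX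
  have hX_copy : ∀ k, IdentDistrib (X k) Z P P' := fun k =>
    (IdentDistrib.of_ae_eq (hX k).aemeasurable (hZX k).symm).trans (h_copy k)
  have hX_id : ∀ k, IdentDistrib (X k) (X 0) P P := fun k => (hX_copy k).trans (hX_copy 0).symm
  have hX_int : Integrable (X 0) P := (hX_copy 0).integrable_iff.2 hZ_int
  have hmean : ∫ ω, X 0 ω ∂P = ∫ ω, Z ω ∂P' := (hX_copy 0).integral_eq
  have hX_pos : 0 < ∫ ω, X 0 ω ∂P := hmean ▸ hZ_pos
  rw [Renewal.renewalMeasure_congr hZX]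
  obtain ⟨C, hC, hH⟩ := Renewal.exists_renewalMeasure_Icc_le hX hX_indep hX_id hX_int hX_pos
  have htop : ∀ a b : ℝ, Renewal.renewalMeasure P X (Icc a b) ≠ ⊤ := by
    intro a b
    refine ne_top_of_le_ne_top ENNReal.ofReal_ne_top
      ((measure_mono (Icc_subset_Icc le_rfl ?_)).trans (hH a |b - a| (abs_nonneg _)))
    linarith [le_abs_self (b - a)]
  have : SFinite (Renewal.renewalMeasure P X) := by
    unfold Renewal.renewalMeasure
    infer_instance
  have hf := Renewal.IsSlowlyVarying.comp_exp hL
  have hbdd := hL_bdd.exists_comp_exp_le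
  obtain ⟨K, hK⟩ := Renewal.exists_deHaan_exp_eq
    (fun b hb => hf.intervalIntegrable hbdd 0 b le_rfl hb) h_fin
  have hD : Tendsto (fun x => Renewal.deHaan L x₀ (Real.exp x)) atTop atTop :=
    h_inf.comp Real.tendsto_exp_atTop
  have hM : Tendsto (fun x => ∫ y in (0 : ℝ)..x, L (Real.exp y)) atTop atTop := by
    refine (tendsto_atTop_add_const_left _ (-K) hD).congr' ?_
    filter_upwards [eventually_ge_atTop 0] with x hx
    rw [hK x hx]
    ring
  refine ⟨hf.integrableOn_comp_sub hbdd htop, ?_⟩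
  have hκ : 0 < 1 / ∫ ω, X 0 ω ∂P := one_div_pos.2 hX_pos
  have hconv := hf.tendsto_integral_div hbdd hM hC hH htop hκ fun ε hε =>
    Renewal.exists_abs_renewalMeasure_Icc_sub_le hX hX_indep hX_id hX_int hX_pos hε
  have hratio : Tendsto (fun x => Renewal.deHaan L x₀ (Real.exp x) /
      ∫ y in (0 : ℝ)..x, L (Real.exp y)) atTop (𝓝 1) := by
    have h1 := (tendsto_const_nhds (x := K)).div_atTop hM |>.add_const 1
    rw [zero_add] at h1
    refine h1.congr' ?_
    filter_upwards [eventually_ge_atTop 0, hM.eventually_gt_atTop 0] with x hx hMx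
    rw [hK x hx, add_div, div_self hMx.ne']
  have hfinal := hconv.div (hratio.const_mul (1 / ∫ ω, X 0 ω ∂P)) (by simpa using hκ.ne')
  rw [mul_one, div_self hκ.ne'] at hfinal
  rw [← hmean]
  refine hfinal.congr' ?_
  filter_upwards [hM.eventually_gt_atTop 0] with x hMx
  simp only [Pi.div_apply]
  rw [← mul_div_assoc, div_div_div_cancel_right₀ hMx.ne']
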